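/- Let $$p(t)=108(2t+3)(3t^2+9t+10)(6t^2+18t+17)\in\mathbb{Z}[t],$$ $$k(t)=-324^2(2t+3)^2(3t^2+9t+10)^2(6t^2+18t+17)^2\,h(t)\in\mathbb{Z}[t],$$ where $$h(t)=108(t^2+3t)^4+612(t^2+3t)^3+300(t^2+3t)^2-3504(t^2+3t)-5329.$$ Then $\mathcal{E}: y^2=x^3+k(t)$ is an elliptic curve over $\mathbb{Q}(t)$, and the four points $$P_1=\bigl(t\,p(t),\;3p(t)(18t^4+54t^3+30t^2-72t-73)\bigr),$$ $$P_2=\bigl((t+1)p(t),\;3p(t)(18t^4+90t^3+192t^2+210t+107)\bigr),$$ $$P_3=\bigl((t+2)p(t),\;3p(t)(18t^4+126t^3+354t^2+456t+233)\bigr),$$ $$P_4=\bigl((t+3)p(t),\;3p(t)(18t^4+162t^3+516t^2+738t+413)\bigr)$$ are $\mathbb{Q}(t)$-rational points on $\mathcal{E}$. Their $x$-coordinates form a nonconstant arithmetic progression, and the points are independent in the group $\mathcal{E}(\mathbb{Q}(t))$, that is, they are linearly independent over $\mathbb{Z}$. In particular, there is a polynomial $k\in\mathbb{Z}[t]$ such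 that the elliptic curve $y^2=x^3+k(t)$ over $\mathbb{Q}(t)$ has four independent $\mathbb{Q}(t)$-rational points in arithmetic progression. -/

import Mathlib

open Polynomial

/-- The affine Weierstrass curve `y² = x³ + k` over a field `F`. -/
def mordellCurve {F : Type*} [Field F] (k : F) : WeierstrassCurve.Affine F :=
  { a₁ := 0, a₂ := 0, a₃ := 0, a₄ := 0, a₆ := k }

/-- The points `P 0, …, P (n - 1)` are affine and their `x`-coordinates form a (nonconstant)
arithmetic progression, in this order. -/
def PointsInAP {F : Type*} [Field F] {W : WeierstrassCurve.Affine F} {n : ℕ}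
    (P : Fin n → W.Point) : Prop :=
  ∃ a d : F, d ≠ 0 ∧ ∀ i : Fin n, ∃ (y : F) (h : W.Nonsingular (a + (i : ℕ) * d) y),
    P i = .some (a + (i : ℕ) * d) y h

/-- An integral polynomial `f(t)`, viewed as an element of `ℚ(t)`. -/
noncomputable def toRatFunc (f : ℤ[X]) : RatFunc ℚ :=
  aeval (RatFunc.X : RatFunc ℚ) f

/-- The polynomial `p(t) = 108 (2t+3) (3t²+9t+10) (6t²+18t+17)`. -/
noncomputable def pPoly : ℤ[X] :=
  108 * (2 * X + 3) * (3 * X ^ 2 + 9 * X + 10) * (6 * X ^ 2 + 18 * X + 17)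

/-- The polynomial `h(t) = 108 u⁴ + 612 u³ + 300 u² - 3504 u - 5329` with `u = t² + 3t`. -/
noncomputable def hPoly : ℤ[X] :=
  108 * (X ^ 2 + 3 * X) ^ 4 + 612 * (X ^ 2 + 3 * X) ^ 3 + 300 * (X ^ 2 + 3 * X) ^ 2
    - 3504 * (X ^ 2 + 3 * X) - 5329

/-- The polynomial `k(t) = -324² (2t+3)² (3t²+9t+10)² (6t²+18t+17)² h(t)`. -/
noncomputable def kPoly : ℤ[X] :=
  -324 ^ 2 * (2 * X + 3) ^ 2 * (3 * X ^ 2 + 9 * X + 10) ^ 2 * (6 * X ^ 2 + 18 * X + 17) ^ 2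
    * hPoly

/-- The four polynomials `q₀, q₁, q₂, q₃` that occur in the `y`-coordinates `3 p(t) qᵢ(t)`. -/
noncomputable def qPoly : Fin 4 → ℤ[X] :=
  ![18 * X ^ 4 + 54 * X ^ 3 + 30 * X ^ 2 - 72 * X - 73,
    18 * X ^ 4 + 90 * X ^ 3 + 192 * X ^ 2 + 210 * X + 107,
    18 * X ^ 4 + 126 * X ^ 3 + 354 * X ^ 2 + 456 * X + 233,
    18 * X ^ 4 + 162 * X ^ 3 + 516 * X ^ 2 + 738 * X + 413]

/-!
That the four points lie on the curve is a polynomial identity; the content is independence, which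
is a `2`-descent read off modulo `7`.

Choose a residue class `t₀` modulo `7` and a `7`-adic integer `τ ≡ t₀` that is transcendental over
`ℚ`; it exists because a `7`-adic ball is uncountable. Then `t ↦ τ` embeds `ℚ(t)` into `ℚ₇`
(`exists_ratFunc_embedding_padic`), so that the whole group `E(ℚ(t))` can be studied over `ℚ₇`
without any specialisation theorem. If `x³ + k(t₀)` has a simple root `c` modulo `7`, Hensel's lemma
lifts it to a root `θ ∈ ℤ₇` of `x³ + k(τ)`, and `(x, y) ↦ x - θ` is a homomorphism from `E(ℚ(t))` to
the square classes of `ℚ₇` (`descentHom`). When the numbers `x(Pᵢ)(t₀) - c` are units modulo `7`,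
the image of a relation `∑ nᵢ Pᵢ = 0` says that the sum of the `nᵢ` over those `i` for which
`x(Pᵢ)(t₀) - c` is a non-square modulo `7` is even (`even_sum_of_relation`).

The pairs `(t₀, c) = (0, 3), (0, 6), (4, 3), (4, 6)` give the four sums `n₂`, `n₁ + n₃`, `n₁`,
`n₀ + n₂`, so all coefficients of a relation are even. As `x³ + k(1)` has no root modulo `7`,
neither has `x³ + k(t)` in `ℚ(t)` (`toRatFunc_kPoly_no_root`); hence there is no `2`-torsion,
relations can be halved indefinitely, and they vanish (`linearIndependent_int_of_even`).
-/

/-! ### The `2`-descent homomorphism on `y² = x³ + k` -/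

section Descent

variable {K L : Type*} [Field K] [Field L]

/-- The group `Lˣ / (Lˣ)²` of square classes of a field, written additively. -/
def SquareClass (L : Type*) [Field L] : Type _ :=
  Additive (Lˣ ⧸ (powMonoidHom 2 : Lˣ →* Lˣ).range)

instance : AddCommGroup (SquareClass L) :=
  inferInstanceAs (AddCommGroup (Additive (Lˣ ⧸ (powMonoidHom 2 : Lˣ →* Lˣ).range)))

/-- The square class of a unit, as a homomorphism of additive groups. -/
def squareClass : Additive Lˣ →+ SquareClass L :=
  MonoidHom.toAdditive (QuotientGroup.mk' (powMonoidHom 2 : Lˣ →* Lˣ).range)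

lemma squareClass_eq_zero_iff {u : Lˣ} : squareClass (.ofMul u) = 0 ↔ ∃ w : Lˣ, w ^ 2 = u :=
  (QuotientGroup.eq_one_iff u).trans MonoidHom.mem_range

lemma squareClass_mul (u v : Lˣ) :
    squareClass (.ofMul (u * v)) = squareClass (.ofMul u) + squareClass (.ofMul v) :=
  rfl

lemma add_self_squareClass (c : SquareClass L) : c + c = 0 := by
  obtain ⟨u, rfl⟩ := QuotientGroup.mk_surjective (s := (powMonoidHom 2 : Lˣ →* Lˣ).range) c
  exact (squareClass_mul u u).symm.trans (squareClass_eq_zero_iff.mpr ⟨u, sq u⟩)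

lemma mordellCurve_equation_iff (k x y : K) :
    (mordellCurve k).Equation x y ↔ y ^ 2 = x ^ 3 + k := by
  simp [WeierstrassCurve.Affine.equation_iff, mordellCurve]

lemma mordellCurve_negY (k x y : K) : (mordellCurve k).negY x y = -y := by
  simp [WeierstrassCurve.Affine.negY, mordellCurve]

lemma mordellCurve_isElliptic {k : K} (h6 : (6 : K) ≠ 0) (hk : k ≠ 0) :
    (mordellCurve k).IsElliptic := by
  have hΔ : (mordellCurve k).Δ = -(12 * 6 ^ 2 * k ^ 2) := by
    simp only [WeierstrassCurve.Δ, WeierstrassCurve.b₂, WeierstrassCurve.b₄,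
      WeierstrassCurve.b₆, WeierstrassCurve.b₈, mordellCurve]
    ring
  have h12 : (12 : K) ≠ 0 := fun h ↦ h6 <| by
    have : (6 : K) * 6 = 0 := by linear_combination 3 * h
    simpa using this
  exact ⟨by rw [hΔ, isUnit_iff_ne_zero, neg_ne_zero]; positivity⟩

lemma mordellCurve_two_torsion_free [DecidableEq K] {k : K} (h2 : (2 : K) ≠ 0)
    (hk : ∀ x : K, x ^ 3 + k ≠ 0) {P : (mordellCurve k).Point} (hP : P + P = 0) : P = 0 := by
  rcases P with _ | ⟨x, y, h⟩
  · rfl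
  · rw [← eq_neg_iff_add_eq_zero, WeierstrassCurve.Affine.Point.neg_some,
      WeierstrassCurve.Affine.Point.some.injEq, mordellCurve_negY] at hP
    have hy : y = 0 := by
      have : 2 * y = 0 := by linear_combination hP.2
      simpa [h2] using this
    have heq := (mordellCurve_equation_iff k x y).mp h.1
    exact absurd (by rw [← heq, hy]; ring) (hk x)

/-- If the line of slope `ℓ` through two points of `y² = x³ + k` meets the curve again over
`x₃`, then `(x₁ - θ)(x₂ - θ)(x₃ - θ)` is a square for every root `θ` of `x³ + k`: it is the
square of the value at `θ` of the equation of the line. -/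
lemma mordellCurve_prod_sub_root [DecidableEq K] {k : K} (ι : K →+* L) {θ : L}
    (hθ : θ ^ 3 + ι k = 0) {x₁ x₂ y₁ y₂ : K} (h₁ : (mordellCurve k).Equation x₁ y₁)
    (h₂ : (mordellCurve k).Equation x₂ y₂)
    (hxy : ¬(x₁ = x₂ ∧ y₁ = (mordellCurve k).negY x₂ y₂)) :
    (ι x₁ - θ) * (ι x₂ - θ) *
      (ι ((mordellCurve k).addX x₁ x₂ ((mordellCurve k).slope x₁ x₂ y₁ y₂)) - θ) =
    (ι ((mordellCurve k).slope x₁ x₂ y₁ y₂) * (θ - ι x₁) + ι y₁) ^ 2 := by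
  have h := congrArg (eval₂ ι θ) (WeierstrassCurve.Affine.addPolynomial_slope h₁ h₂ hxy)
  generalize (mordellCurve k).slope x₁ x₂ y₁ y₂ = ℓ at h ⊢
  generalize (mordellCurve k).addX x₁ x₂ ℓ = x₃ at h ⊢
  rw [WeierstrassCurve.Affine.addPolynomial_eq] at h
  simp only [mordellCurve, Cubic.toPoly, eval₂_neg, eval₂_mul, eval₂_sub, eval₂_add, eval₂_pow,
    eval₂_zero, eval₂_one, eval₂_ofNat,
    eval₂_X, eval₂_C, map_neg, map_sub, map_add, map_mul, map_pow, map_one, map_zero,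
    map_ofNat] at h
  linear_combination -h - hθ

variable {k : K} (ι : K →+* L) {θ : L} (hθ : θ ^ 3 + ι k = 0) (hk : ∀ x : K, x ^ 3 + k ≠ 0)

lemma map_sub_root_ne_zero (hθ : θ ^ 3 + ι k = 0) (hk : ∀ x : K, x ^ 3 + k ≠ 0) (x : K) :
    ι x - θ ≠ 0 := fun h ↦
  hk x <| ι.injective <| by rw [map_add, map_pow, map_zero, sub_eq_zero.mp h, hθ]

/-- The square class of `x - θ` at an affine point `(x, y)`, and the trivial class at infinity. -/
def descentFun : (mordellCurve k).Point → SquareClass L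
  | .zero => 0
  | .some x _ _ => squareClass (.ofMul <| Units.mk0 (ι x - θ) (map_sub_root_ne_zero ι hθ hk x))

/-- The `2`-descent homomorphism `(x, y) ↦ x - θ` from the points of `y² = x³ + k` over `K` to the
square classes of an extension `L` that contains a root `θ` of `x³ + k`. The polynomial `x³ + k`
is assumed to have no root in `K`, so that `x - θ` never vanishes. -/
def descentHom [DecidableEq K] : (mordellCurve k).Point →+ SquareClass L :=
  AddMonoidHom.mk' (descentFun ι hθ hk) <| by
    -- Square classes are `2`-torsion, so additivity follows from the symmetric relation that the
    -- line through the points provides.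
    have key : ∀ a b c : SquareClass L, a + b + c = 0 → c = a + b := fun a b c h ↦ by
      rw [eq_neg_of_add_eq_zero_right h, neg_eq_of_add_eq_zero_left (add_self_squareClass (a + b))]
    rintro (_ | ⟨x₁, y₁, h₁⟩) (_ | ⟨x₂, y₂, h₂⟩)
    · exact (add_zero (0 : SquareClass L)).symm
    · exact (zero_add (descentFun ι hθ hk (.some x₂ y₂ h₂))).symm
    · exact (add_zero (descentFun ι hθ hk (.some x₁ y₁ h₁))).symm
    · by_cases hxy : x₁ = x₂ ∧ y₁ = (mordellCurve k).negY x₂ y₂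
      · rw [WeierstrassCurve.Affine.Point.add_of_Y_eq hxy.1 hxy.2]
        obtain ⟨rfl, -⟩ := hxy
        exact (add_self_squareClass _).symm
      · rw [WeierstrassCurve.Affine.Point.add_some hxy]
        apply key
        simp only [descentFun, ← squareClass_mul]
        have hprod := mordellCurve_prod_sub_root ι hθ h₁.1 h₂.1 hxy
        refine squareClass_eq_zero_iff.mpr ⟨Units.mk0
          (ι ((mordellCurve k).slope x₁ x₂ y₁ y₂) * (θ - ι x₁) + ι y₁) fun h0 ↦ ?_, ?_⟩
        · rw [h0, zero_pow two_ne_zero] at hprod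
          exact mul_ne_zero (mul_ne_zero (map_sub_root_ne_zero ι hθ hk _)
            (map_sub_root_ne_zero ι hθ hk _)) (map_sub_root_ne_zero ι hθ hk _) hprod
        · ext
          simpa using hprod.symm

lemma descentHom_some [DecidableEq K] {x y : K} (h : (mordellCurve k).Nonsingular x y) :
    descentHom ι hθ hk (.some x y h) =
      squareClass (.ofMul <| Units.mk0 (ι x - θ) (map_sub_root_ne_zero ι hθ hk x)) :=
  rfl

end Descent

/-! ### Independence from parity of relations -/

/-- If every integral relation between the `v i` has only even coefficients and there is no
`2`-torsion, then halving relations forever shows that there are only trivial ones. -/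
lemma linearIndependent_int_of_even {ι A : Type*} [Fintype ι] [AddCommGroup A] {v : ι → A}
    (h2 : ∀ a : A, a + a = 0 → a = 0)
    (hv : ∀ n : ι → ℤ, ∑ i, n i • v i = 0 → ∀ i, Even (n i)) : LinearIndependent ℤ v := by
  have hdvd : ∀ (m : ℕ) (n : ι → ℤ), ∑ i, n i • v i = 0 → ∀ i, 2 ^ m ∣ n i := by
    intro m
    induction m with
    | zero => simp
    | succ m ih =>
      intro n hn
      choose c hc using hv n hn
      have hc0 : ∑ i, c i • v i = 0 := h2 _ <| by
        simpa only [← Finset.sum_add_distrib, ← add_smul, ← hc] using hn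
      intro i
      rw [hc, ← two_mul, pow_succ']
      exact mul_dvd_mul_left 2 (ih c hc0 i)
  refine Fintype.linearIndependent_iff.mpr fun n hn i ↦ ?_
  refine Int.eq_zero_of_dvd_of_natAbs_lt_natAbs (hdvd (n i).natAbs n hn i) ?_
  simpa [Int.natAbs_pow] using Nat.lt_two_pow_self

/-! ### Embedding `ℚ(t)` into `ℚ_p` and reducing square classes modulo `p` -/

section Padic

variable {p : ℕ} [Fact p.Prime]

/-- The `ℤ`-algebra structures are arbitrary because `RatFunc ℚ` carries one that is not
syntactically that of a ring. -/
lemma map_aeval_int {R S : Type*} [CommRing R] [CommRing S] [Algebra ℤ R] [Algebra ℤ S]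
    (φ : R →+* S) (x : R) (f : ℤ[X]) :
    φ (aeval x f) = aeval (φ x) f := by
  rw [aeval_def, aeval_def, hom_eval₂]
  congr 1
  exact RingHom.ext_int _ _

lemma exists_transcendental_padicInt (a : ZMod p) :
    ∃ τ : ℤ_[p], PadicInt.toZMod τ = a ∧ Transcendental ℚ (τ : ℚ_[p]) := by
  obtain ⟨c, rfl⟩ := ZMod.ringHom_surjective (PadicInt.toZMod (p := p)) a
  -- The open residue disc around `c` is uncountable, while the algebraic numbers are countable.
  have hball : ¬ (Metric.ball (c : ℚ_[p]) 1).Countable := fun h ↦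
    (Cardinal.aleph0_lt_continuum.trans_le (continuum_le_cardinal_of_isOpen ℚ_[p]
      Metric.isOpen_ball ⟨_, Metric.mem_ball_self one_pos⟩)).not_ge h.le_aleph0
  obtain ⟨x, hx, hxt⟩ := Set.not_subset.mp fun hsub ↦
    hball ((Algebraic.countable ℚ ℚ_[p]).mono hsub)
  rw [Metric.mem_ball, dist_eq_norm] at hx
  obtain ⟨d, hd⟩ : ∃ d : ℤ_[p], (d : ℚ_[p]) = x - c := ⟨⟨x - c, hx.le⟩, rfl⟩
  rw [← hd] at hx
  refine ⟨c + d, ?_, ?_⟩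
  · rw [map_add, add_eq_left, ← RingHom.mem_ker, PadicInt.ker_toZMod,
      IsLocalRing.mem_maximalIdeal, PadicInt.mem_nonunits]
    exact hx
  · rw [PadicInt.coe_add, hd, add_sub_cancel]
    exact hxt

/-- `ℚ(t)` embeds into `ℚ_p` with `t` sent to a `p`-adic integer in a given residue class. On
integral polynomials the embedding is evaluation, hence lifts evaluation modulo `p`. -/
lemma exists_ratFunc_embedding_padic (a : ZMod p) :
    ∃ (ι : RatFunc ℚ →+* ℚ_[p]) (ev : ℤ[X] →+* ℤ_[p]),
      (∀ f, ι (toRatFunc f) = ev f) ∧ ∀ f, PadicInt.toZMod (ev f) = aeval a f := by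
  obtain ⟨τ, rfl, hτ⟩ := exists_transcendental_padicInt a
  have hinj : Function.Injective (aeval (R := ℚ) (τ : ℚ_[p])) :=
    transcendental_iff_injective.mp hτ
  let ι : RatFunc ℚ →+* ℚ_[p] := RatFunc.liftRingHom (aeval (R := ℚ) (τ : ℚ_[p])).toRingHom
    (nonZeroDivisors_le_comap_nonZeroDivisors_of_injective _ hinj)
  have hX : ι RatFunc.X = τ := by
    rw [← RatFunc.algebraMap_X]
    exact (RatFunc.liftRingHom_algebraMap _ _ _).trans (by simp)
  refine ⟨ι, (aeval (R := ℤ) τ).toRingHom, fun f ↦ ?_, fun f ↦ ?_⟩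
  · change ι (aeval RatFunc.X f) = PadicInt.Coe.ringHom (p := p) (aeval τ f)
    rw [map_aeval_int, map_aeval_int, hX]
    rfl
  · exact map_aeval_int _ τ f

/-- Hensel's lemma for `x³ + κ` over the `p`-adic integers. -/
lemma exists_padicInt_root {κ : ℤ_[p]} {c : ZMod p} (hp : 3 * c ^ 2 ≠ 0)
    (hc : c ^ 3 + PadicInt.toZMod κ = 0) :
    ∃ θ : ℤ_[p], θ ^ 3 + κ = 0 ∧ PadicInt.toZMod θ = c := by
  obtain ⟨b, rfl⟩ := ZMod.ringHom_surjective (PadicInt.toZMod (p := p)) c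
  have hunit : IsUnit (3 * b ^ 2) := by
    rw [← not_not (a := IsUnit _), ← mem_nonunits_iff, ← IsLocalRing.mem_maximalIdeal,
      ← PadicInt.ker_toZMod, RingHom.mem_ker, map_mul, map_pow, map_ofNat]
    exact hp
  obtain ⟨θ, hθ, hb⟩ := HenselianRing.is_henselian (I := IsLocalRing.maximalIdeal ℤ_[p])
    (X ^ 3 + C κ) (monic_X_pow_add_C κ three_ne_zero) b
    (by rw [← PadicInt.ker_toZMod, RingHom.mem_ker]; simpa using hc)
    (IsUnit.map _ (by simpa [two_add_one_eq_three] using hunit))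
  refine ⟨θ, by simpa using hθ, ?_⟩
  rwa [← PadicInt.ker_toZMod, RingHom.mem_ker, map_sub, sub_eq_zero] at hb

/-- An `m`-th root in `ℚ_p` of a `p`-adic integer is a `p`-adic integer. -/
lemma exists_padicInt_of_pow {w : ℚ_[p]} {m : ℕ} (hm : m ≠ 0) {a : ℤ_[p]} (h : w ^ m = a) :
    ∃ v : ℤ_[p], (v : ℚ_[p]) = w ∧ v ^ m = a := by
  have hw : ‖w‖ ≤ 1 := by
    rw [← pow_le_one_iff_of_nonneg (norm_nonneg w) hm, ← norm_pow, h]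
    exact PadicInt.norm_le_one a
  obtain ⟨v, rfl⟩ : ∃ v : ℤ_[p], (v : ℚ_[p]) = w := ⟨⟨w, hw⟩, rfl⟩
  exact ⟨v, rfl, PadicInt.ext (by rw [PadicInt.coe_pow, h])⟩

/-- A `p`-adic unit that becomes a square in `ℚ_p` reduces to a square modulo `p`. -/
lemma quadraticChar_toZMod_eq_one_of_sq {u : ℤ_[p]ˣ} {w : ℚ_[p]}
    (h : w ^ 2 = ((u : ℤ_[p]) : ℚ_[p])) :
    quadraticChar (ZMod p) (PadicInt.toZMod (u : ℤ_[p])) = 1 := by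
  obtain ⟨v, -, hv⟩ := exists_padicInt_of_pow two_ne_zero h
  have hne : PadicInt.toZMod v ≠ 0 := fun h0 ↦
    (u.isUnit.map (PadicInt.toZMod (p := p))).ne_zero (by rw [← hv, map_pow, h0]; simp)
  rw [← hv, map_pow]
  exact quadraticChar_sq_one' hne

/-- A relation between square classes of `p`-adic units forces a parity condition on the exponents
of the units that reduce to non-squares. -/
lemma even_sum_of_sum_squareClass_eq_zero {m : ℕ} {u : Fin m → ℤ_[p]ˣ} {s : Fin m → ℕ}
    (hs : ∀ i, quadraticChar (ZMod p) (PadicInt.toZMod (u i : ℤ_[p])) = (-1) ^ s i)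
    {n : Fin m → ℤ}
    (h : ∑ i, n i • squareClass
      (.ofMul <| Units.map (PadicInt.Coe.ringHom (p := p)).toMonoidHom (u i)) = 0) :
    Even (∑ i, s i * n i) := by
  have hsq : squareClass (.ofMul <| Units.map (PadicInt.Coe.ringHom (p := p)).toMonoidHom
      (∏ i, u i ^ n i)) = 0 := by
    rw [← h, map_prod, ofMul_prod, map_sum]
    simp only [map_zpow, ofMul_zpow, map_zsmul]
  obtain ⟨w, hw⟩ := squareClass_eq_zero_iff.mp hsq
  have h1 := quadraticChar_toZMod_eq_one_of_sq (congrArg Units.val hw)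
  let χ : ℤ_[p]ˣ →* ℤˣ := Units.map
    ((quadraticChar (ZMod p)).toMonoidHom.comp (PadicInt.toZMod (p := p)).toMonoidHom)
  have hχ : ∀ i, χ (u i) = (-1) ^ (s i : ℤ) := fun i ↦ Units.ext (by simpa [χ] using hs i)
  have h2 : χ (∏ i, u i ^ n i) = 1 := Units.ext h1
  rw [← Int.negOnePow_eq_one_iff, ← h2, map_prod]
  simp only [map_zpow, hχ, ← zpow_mul, Int.negOnePow_def]
  exact Finset.sum_smul (f := fun i ↦ (s i : ℤ) * n i) (x := Additive.ofMul (-1 : ℤˣ))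

/-- The parity condition that the residue class of a specialisation `t` and a simple root `c` of
`x³ + f(t)` modulo `p` impose on a relation between points of `y² = x³ + f` over `ℚ(t)` whose
`x`-coordinates are integral polynomials. -/
lemma even_sum_of_relation [DecidableEq (RatFunc ℚ)] {f : ℤ[X]}
    (hf : ∀ x : RatFunc ℚ, x ^ 3 + toRatFunc f ≠ 0) {m : ℕ} {x : Fin m → ℤ[X]}
    {P : Fin m → (mordellCurve (toRatFunc f)).Point}
    (hP : ∀ i, ∃ y h, P i = .some (toRatFunc (x i)) y h)
    {n : Fin m → ℤ} (hn : ∑ i, n i • P i = 0) (t c : ZMod p) (s : Fin m → ℕ)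
    (hc : c ^ 3 + aeval t f = 0) (hc' : 3 * c ^ 2 ≠ 0)
    (hs : ∀ i, quadraticChar (ZMod p) (aeval t (x i) - c) = (-1) ^ s i) :
    Even (∑ i, s i * n i) := by
  obtain ⟨ι, ev, hι, hev⟩ := exists_ratFunc_embedding_padic t
  obtain ⟨θ, hθ, rfl⟩ := exists_padicInt_root hc' (κ := ev f) (by rw [hev, hc])
  have hθ' : (θ : ℚ_[p]) ^ 3 + ι (toRatFunc f) = 0 := by
    rw [hι, ← PadicInt.coe_pow, ← PadicInt.coe_add, hθ, PadicInt.coe_zero]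
  have hu : ∀ i, IsUnit (ev (x i) - θ) := fun i ↦ by
    rw [← not_not (a := IsUnit _), ← mem_nonunits_iff, ← IsLocalRing.mem_maximalIdeal,
      ← PadicInt.ker_toZMod, RingHom.mem_ker, map_sub, hev]
    -- `quadraticChar` vanishes only at `0`, so `hs` makes the residue of `ev (x i) - θ` nonzero.
    intro h0
    have := hs i
    rw [h0, quadraticChar_zero] at this
    exact pow_ne_zero _ (by norm_num) this.symm
  choose u hu using hu
  refine even_sum_of_sum_squareClass_eq_zero (u := u) (fun i ↦ by rw [hu, map_sub, hev, hs]) ?_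
  have h := congrArg (descentHom ι hθ' hf) hn
  rw [map_sum, map_zero] at h
  rw [← h]
  refine Finset.sum_congr rfl fun i _ ↦ ?_
  obtain ⟨y, hy, hPi⟩ := hP i
  rw [map_zsmul, hPi, descentHom_some]
  congr 3
  ext
  change PadicInt.Coe.ringHom (u i : ℤ_[p]) = ι _ - θ
  rw [hu, map_sub, hι]
  rfl

end Padic

/-! ### The curve over `ℚ(t)` and its four points -/

instance fact_prime_seven : Fact (Nat.Prime 7) :=
  ⟨by norm_num⟩

/-- An embedding that sends `t` to the class of `1` turns a root into a `7`-adic cube root of an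
integer that is not a cube modulo `7`. -/
lemma toRatFunc_kPoly_no_root (x : RatFunc ℚ) : x ^ 3 + toRatFunc kPoly ≠ 0 := by
  intro hx
  obtain ⟨ι, ev, hι, hev⟩ := exists_ratFunc_embedding_padic (1 : ZMod 7)
  have h : ι x ^ 3 = -(ev kPoly : ℚ_[7]) := by
    rw [← hι, ← map_pow, ← map_neg, eq_neg_of_add_eq_zero_left hx]
  obtain ⟨v, -, hv⟩ := exists_padicInt_of_pow three_ne_zero (h.trans (PadicInt.coe_neg _).symm)
  have h7 := congrArg (PadicInt.toZMod (p := 7)) hv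
  rw [map_pow, map_neg, hev] at h7
  simp only [kPoly, hPoly, map_mul, map_add, map_sub, map_neg, map_pow, aeval_X, map_ofNat] at h7
  generalize PadicInt.toZMod v = c at h7
  revert c
  decide

lemma pPoly_qPoly_identity (i : Fin 4) :
    (3 * pPoly * qPoly i) ^ 2 = ((X + ((i : ℕ) : ℤ[X])) * pPoly) ^ 3 + kPoly := by
  fin_cases i <;> simp [pPoly, qPoly, kPoly, hPoly] <;> ring

theorem theorem2 [DecidableEq (RatFunc ℚ)] :
    (mordellCurve (toRatFunc kPoly)).IsElliptic ∧
    ∃ P : Fin 4 → (mordellCurve (toRatFunc kPoly)).Point,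
      (∀ i : Fin 4, ∃ h : (mordellCurve (toRatFunc kPoly)).Nonsingular
          (toRatFunc ((X + ((i : ℕ) : ℤ[X])) * pPoly)) (toRatFunc (3 * pPoly * qPoly i)),
        P i = .some (toRatFunc ((X + ((i : ℕ) : ℤ[X])) * pPoly))
          (toRatFunc (3 * pPoly * qPoly i)) h) ∧
      PointsInAP P ∧
      LinearIndependent ℤ P := by
  have hk := toRatFunc_kPoly_no_root
  have hE : (mordellCurve (toRatFunc kPoly)).IsElliptic :=
    mordellCurve_isElliptic (by norm_num) fun h ↦ hk 0 (by rw [h]; norm_num)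
  have hns : ∀ i : Fin 4, (mordellCurve (toRatFunc kPoly)).Nonsingular
      (toRatFunc ((X + ((i : ℕ) : ℤ[X])) * pPoly)) (toRatFunc (3 * pPoly * qPoly i)) := fun i ↦ by
    rw [← WeierstrassCurve.Affine.equation_iff_nonsingular, mordellCurve_equation_iff]
    simpa only [toRatFunc, map_pow, map_add] using
      congrArg (aeval (RatFunc.X : RatFunc ℚ)) (pPoly_qPoly_identity i)
  have hx : ∀ i : Fin 4, toRatFunc ((X + ((i : ℕ) : ℤ[X])) * pPoly) =
      toRatFunc (X * pPoly) + (i : ℕ) * toRatFunc pPoly := fun i ↦ by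
    simp only [toRatFunc, add_mul, map_add, map_mul, map_natCast]
  refine ⟨hE, fun i ↦ .some _ _ (hns i), fun i ↦ ⟨hns i, rfl⟩, ?_, ?_⟩
  · refine ⟨toRatFunc (X * pPoly), toRatFunc pPoly, fun h ↦ ?_, fun i ↦
      ⟨_, hx i ▸ hns i, (WeierstrassCurve.Affine.Point.some.injEq ..).mpr ⟨hx i, rfl⟩⟩⟩
    refine hk 0 ?_
    have h' : kPoly = -9 * hPoly * pPoly ^ 2 := by
      rw [kPoly, pPoly]
      ring
    simp only [toRatFunc] at h
    simp [toRatFunc, h', h]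
  · refine linearIndependent_int_of_even
      (fun P ↦ mordellCurve_two_torsion_free two_ne_zero hk) fun n hn ↦ ?_
    have key := even_sum_of_relation (p := 7) hk (fun i ↦ ⟨_, hns i, rfl⟩) hn
    -- Each vector marks the points whose `x - c` is a non-square modulo `7`.
    have h₁ := key 0 3 ![0, 0, 1, 0]
    have h₂ := key 0 6 ![0, 1, 0, 1]
    have h₃ := key 4 3 ![0, 1, 0, 0]
    have h₄ := key 4 6 ![1, 0, 1, 0]
    simp only [kPoly, hPoly, pPoly, map_mul, map_add, map_sub, map_neg, map_pow, aeval_X,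
      map_ofNat, map_natCast] at h₁ h₂ h₃ h₄
    replace h₁ := h₁ (by decide) (by decide) (by decide)
    replace h₂ := h₂ (by decide) (by decide) (by decide)
    replace h₃ := h₃ (by decide) (by decide) (by decide)
    replace h₄ := h₄ (by decide) (by decide) (by decide)
    simp only [Fin.sum_univ_four, Fin.isValue, Matrix.cons_val, Nat.cast_zero, Nat.cast_one,
      zero_mul, one_mul, zero_add, add_zero, Int.even_add] at h₁ h₂ h₃ h₄
    intro i
    fin_cases i
    · exact h₄.mpr h₁
    · exact h₃
    · exact h₁
    · exact h₂.mp h₃
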